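/- Let $\Gamma\subset \mathrm{PSL}(2,\mathbb Z)=\mathrm{SL}(2,\mathbb Z)/\{\pm1\}$ be a subgroup of finite index, let $\Gamma'\subset \mathrm{SL}(2,\mathbb Z)$ be its full preimage, and consider the central extension $$1\to \mathbb Z_2\to \Gamma'\to\Gamma\to 1,\qquad \mathbb Z_2=\{\pm 1\}, \tag{$*$}$$ induced by $1\to\{\pm1\}\to \mathrm{SL}(2,\mathbb Z)\to \mathrm{PSL}(2,\mathbb Z)\to 1$. Let $\overline{\mathcal H}=\mathcal H\cup\mathbb P^1(\mathbb Q)$ be the extended upper half-plane with the usual (horoball) topology, let $M_\Gamma=\overline{\mathcal H}/\Gamma$, and let $j_\Gamma\colon M_\Gamma\to\overline{\mathcal H}/\mathrm{PSL}(2,\mathbb Z)=\mathbb P^1$ be the natural map. The standard triangulation of $\mathbb P^1$ has as vertices the classes $A,B,I$ of $\rho=(-1+\sqrt{-3})/2$, of $i$ and of $\infty$ (the points $0,1,\infty$ of the $j$-line, with $j$ normalised by $j(i)=1$). Its three open edges are the images of the open hyperbolic segments joining $i$ to $\infty$, $\rho$ to $\infty$ and $\rho$ to $i$, and its two open triangles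 are the images of the left and right halves of the open standard fundamental domain. The $ABI$-triangulation of $M_\Gamma$ is the preimage of this triangulation under $j_\Gamma$: its vertices of colour $A$, $B$, $I$ are the points over $A$, $B$, $I$, and its open edges and open triangles are the connected components of the preimages of the open edges and open triangles. The valence of a vertex is the number of edges ending at it, and a $B_2$-vertex is a vertex of colour $B$ and valence $2$. Then the following are equivalent: 1. $\Gamma$ contains no element of order $2$; 2. the extension $(*)$ splits, i.e. $\Gamma'\to\Gamma$ has a section that is a group homomorphism; 3. the extension $(*)$ is isomorphic to the trivial extension, i.e. there is an isomorphism $\Gamma'\cong\mathbb Z_2\times\Gamma$ compatible with the inclusions of $\mathbb Z_2$ and the projections to $\Gamma$; 4. the $ABI$-triangulation of $M_\Gamma$ has no $B_2$-vertices. In particular, if $\Gamma$ contains no element of order $2$, then the exact sequence $(*)$ splits. -/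

import Mathlib

open scoped MatrixGroups UpperHalfPlane

noncomputable section

namespace JModular

/-! ### The central extension attached to a subgroup of `PSL(2, ℤ)` -/

/-- The preimage `Γ'` in `SL(2, ℤ)` of a subgroup `Γ` of `PSL(2, ℤ) = SL(2, ℤ) / center`. -/
def preimage (Γ : Subgroup PSL(2, ℤ)) : Subgroup SL(2, ℤ) :=
  Γ.comap (QuotientGroup.mk' (Subgroup.center SL(2, ℤ)))

/-- The homomorphism `ℤ₂ = {±1} → SL(2, ℤ)`, `u ↦ u • 1`. -/
def signHom : ℤˣ →* SL(2, ℤ) where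
  toFun u := ⟨!![(u : ℤ), 0; 0, (u : ℤ)], by
    rw [Matrix.det_fin_two_of, Int.units_coe_mul_self]; simp⟩
  map_one' := by
    apply Subtype.ext
    simp [Matrix.one_fin_two]
  map_mul' u v := by
    apply Subtype.ext
    change !![((u * v : ℤˣ) : ℤ), 0; 0, ((u * v : ℤˣ) : ℤ)] =
      !![(u : ℤ), 0; 0, (u : ℤ)] * !![(v : ℤ), 0; 0, (v : ℤ)]
    simp

theorem coe_signHom (u : ℤˣ) :
    (signHom u : Matrix (Fin 2) (Fin 2) ℤ) = !![(u : ℤ), 0; 0, (u : ℤ)] := rfl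

theorem mem_center_iff_signHom (g : SL(2, ℤ)) :
    g ∈ Subgroup.center SL(2, ℤ) ↔ ∃ u : ℤˣ, signHom u = g := by
  have hs : ∀ r : ℤ, Matrix.scalar (Fin 2) r = !![r, 0; 0, r] := fun r => by
    rw [Matrix.scalar_apply]
    ext i j; fin_cases i <;> fin_cases j <;> simp
  rw [Matrix.SpecialLinearGroup.mem_center_iff]
  constructor
  · rintro ⟨r, hr, hg⟩
    have hr' : r * r = 1 := by simpa [pow_two] using hr
    exact ⟨⟨r, r, hr', hr'⟩, Subtype.ext ((hs r).symm.trans hg)⟩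
  · rintro ⟨u, rfl⟩
    refine ⟨u, ?_, hs u⟩
    rcases Int.units_eq_one_or u with rfl | rfl <;> simp

theorem signHom_injective : Function.Injective signHom := by
  intro u v h
  have h1 := congrArg (fun g : SL(2, ℤ) => (g : Matrix (Fin 2) (Fin 2) ℤ) 0 0) h
  apply Units.ext
  simpa [coe_signHom] using h1

/-- The exact sequence `1 → ℤ₂ → Γ' → Γ → 1` induced by
`1 → ℤ₂ → SL(2, ℤ) → PSL(2, ℤ) → 1`, where `ℤ₂ = {±1}`. -/
def extension (Γ : Subgroup PSL(2, ℤ)) : GroupExtension ℤˣ (preimage Γ) Γ where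
  inl := signHom.codRestrict (preimage Γ) fun u => by
    have h : QuotientGroup.mk' (Subgroup.center SL(2, ℤ)) (signHom u) = 1 :=
      (QuotientGroup.eq_one_iff _).2 ((mem_center_iff_signHom _).2 ⟨u, rfl⟩)
    change QuotientGroup.mk' (Subgroup.center SL(2, ℤ)) (signHom u) ∈ Γ
    rw [h]
    exact Γ.one_mem
  rightHom := (QuotientGroup.mk' (Subgroup.center SL(2, ℤ))).subgroupComap Γ
  inl_injective u v h := signHom_injective (congrArg Subtype.val h)
  range_inl_eq_ker_rightHom := by
    ext g
    have h1 : (QuotientGroup.mk' (Subgroup.center SL(2, ℤ))).subgroupComap Γ g = 1 ↔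
        (g : SL(2, ℤ)) ∈ Subgroup.center SL(2, ℤ) := by
      rw [← QuotientGroup.eq_one_iff]
      exact Subtype.ext_iff
    refine Iff.trans ?_ h1.symm
    rw [mem_center_iff_signHom]
    exact exists_congr fun u => Subtype.ext_iff
  rightHom_surjective := by
    rintro ⟨x, hx⟩
    obtain ⟨g, rfl⟩ := QuotientGroup.mk'_surjective _ x
    exact ⟨⟨g, hx⟩, rfl⟩

/-- The trivial extension `1 → N → N × G → G → 1`. -/
def trivialExtension (N G : Type*) [Group N] [Group G] : GroupExtension N (N × G) G where
  inl := MonoidHom.inl N G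
  rightHom := MonoidHom.snd N G
  inl_injective := fun _ _ h => congrArg Prod.fst h
  range_inl_eq_ker_rightHom := by
    ext ⟨a, b⟩
    constructor
    · rintro ⟨c, hc⟩
      exact (congrArg Prod.snd hc).symm
    · intro h
      exact ⟨a, Prod.ext rfl (Eq.symm h)⟩
  rightHom_surjective := fun b => ⟨(1, b), rfl⟩

/-! ### The extended upper half-plane and the curve `M_Γ` -/

/-- The extended upper half-plane: the upper half-plane together with the cusps
`ℙ¹(ℚ) = ℚ ∪ {∞}`. -/
inductive ExtHalfPlane : Type
  | point (z : ℍ) : ExtHalfPlane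
  | cusp (c : OnePoint ℚ) : ExtHalfPlane

/-- `SL(2, ℤ)` acts on the points of `ℍ` and on the cusps by Möbius transformations. -/
instance : MulAction SL(2, ℤ) ExtHalfPlane where
  smul g x := match x with
    | .point z => .point (g • z)
    | .cusp c => .cusp (Matrix.SpecialLinearGroup.mapGL ℚ g • c)
  one_smul x := by
    rcases x with z | c
    · exact congrArg ExtHalfPlane.point (one_smul _ z)
    · refine congrArg ExtHalfPlane.cusp ?_
      rw [map_one, one_smul]
  mul_smul g h x := by
    rcases x with z | c
    · exact congrArg ExtHalfPlane.point (mul_smul g h z)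
    · refine congrArg ExtHalfPlane.cusp ?_
      rw [map_mul, mul_smul]

theorem smul_point (g : SL(2, ℤ)) (z : ℍ) :
    g • ExtHalfPlane.point z = ExtHalfPlane.point (g • z) := rfl

theorem smul_cusp (g : SL(2, ℤ)) (c : OnePoint ℚ) :
    g • ExtHalfPlane.cusp c =
      ExtHalfPlane.cusp (Matrix.SpecialLinearGroup.mapGL ℚ g • c) := rfl

theorem signHom_smul (u : ℤˣ) (x : ExtHalfPlane) : signHom u • x = x := by
  rcases Int.units_eq_one_or u with rfl | rfl
  · rw [map_one, one_smul]
  · have h : signHom (-1) = -1 := by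
      ext i j; fin_cases i <;> fin_cases j <;> simp [coe_signHom]
    rw [h]
    rcases x with z | c
    · rw [smul_point, ModularGroup.SL_neg_smul, one_smul]
    · rw [smul_cusp]
      congr 1
      induction c using OnePoint.rec with
      | infty => rw [OnePoint.smul_infty_eq_self_iff]; simp
      | coe q => rw [OnePoint.smul_some_eq_ite]; simp

/-- The induced action of `PSL(2, ℤ)` on the extended upper half-plane. -/
instance : MulAction PSL(2, ℤ) ExtHalfPlane :=
  MulAction.compHom ExtHalfPlane
    (QuotientGroup.lift (Subgroup.center SL(2, ℤ)) (MulAction.toPermHom SL(2, ℤ) ExtHalfPlane)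
      fun g hg => by
        obtain ⟨u, rfl⟩ := (mem_center_iff_signHom g).1 hg
        ext x
        exact signHom_smul u x)

theorem mk_smul (g : SL(2, ℤ)) (x : ExtHalfPlane) : (g : PSL(2, ℤ)) • x = g • x := rfl

/-- The usual (horoball) topology on the extended upper half-plane: `U` is open if its trace on
`ℍ` is open and if, for every cusp `γ ∞` in `U`, the set `U` contains the image under `γ` of
some half-plane `{Im z > C}`. -/
instance : TopologicalSpace ExtHalfPlane where
  IsOpen U := IsOpen {z : ℍ | ExtHalfPlane.point z ∈ U} ∧
    ∀ γ : SL(2, ℤ), γ • ExtHalfPlane.cusp OnePoint.infty ∈ U →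
      ∃ C : ℝ, ∀ z : ℍ, C < z.im → γ • ExtHalfPlane.point z ∈ U
  isOpen_univ := ⟨isOpen_univ, fun _ _ => ⟨0, fun _ _ => trivial⟩⟩
  isOpen_inter U V hU hV := by
    refine ⟨hU.1.inter hV.1, fun γ hγ => ?_⟩
    obtain ⟨C, hC⟩ := hU.2 γ hγ.1
    obtain ⟨D, hD⟩ := hV.2 γ hγ.2
    exact ⟨max C D, fun z hz =>
      ⟨hC z ((le_max_left _ _).trans_lt hz), hD z ((le_max_right _ _).trans_lt hz)⟩⟩
  isOpen_sUnion S hS := by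
    refine ⟨?_, ?_⟩
    · have h : {z : ℍ | ExtHalfPlane.point z ∈ ⋃₀ S} =
          ⋃ U ∈ S, {z : ℍ | ExtHalfPlane.point z ∈ U} := by
        ext z; simp
      rw [h]
      exact isOpen_biUnion fun U hU => (hS U hU).1
    · rintro γ ⟨U, hU, hγ⟩
      obtain ⟨C, hC⟩ := (hS U hU).2 γ hγ
      exact ⟨C, fun z hz => ⟨U, hU, hC z hz⟩⟩

/-- The `j`-modular curve `M_Γ`: the quotient of the extended upper half-plane by `Γ`. -/
def ModularCurve (Γ : Subgroup PSL(2, ℤ)) : Type :=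
  Quotient (MulAction.orbitRel Γ ExtHalfPlane)

/-- `M_Γ` carries the quotient topology. -/
instance (Γ : Subgroup PSL(2, ℤ)) : TopologicalSpace (ModularCurve Γ) :=
  inferInstanceAs (TopologicalSpace (Quotient (MulAction.orbitRel Γ ExtHalfPlane)))

/-- The quotient map onto `M_Γ`. -/
def toCurve (Γ : Subgroup PSL(2, ℤ)) (x : ExtHalfPlane) : ModularCurve Γ :=
  Quotient.mk (MulAction.orbitRel Γ ExtHalfPlane) x

/-- The `j`-line, i.e. the sphere `ℙ¹` obtained as the quotient of the extended upper half-plane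
by the full group `PSL(2, ℤ)`. -/
abbrev JLine : Type := ModularCurve ⊤

/-- The natural map `j_Γ : M_Γ → M_{PSL(2, ℤ)} = ℙ¹`. -/
def jMap (Γ : Subgroup PSL(2, ℤ)) : ModularCurve Γ → JLine :=
  Quotient.lift (toCurve ⊤) fun x y h => by
    obtain ⟨g, hg⟩ := MulAction.orbitRel_apply.1 h
    exact Quotient.sound (MulAction.orbitRel_apply.2 ⟨⟨g, trivial⟩, hg⟩)

/-! ### The `ABI`-triangulation -/

/-- The three colours of vertices. -/
inductive Colour : Type
  | A
  | B
  | I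

/-- The elliptic point `ρ = (-1 + √3 i) / 2` of order three. -/
def rho : ℍ := ⟨⟨-1 / 2, √3 / 2⟩, by positivity⟩

/-- The vertices of the standard triangulation of the sphere `ℙ¹`: the points
`A = 0`, `B = 1`, `I = ∞` of the `j`-line (for `j` normalised by `j(i) = 1`), that is, the
classes of `ρ`, of `i` and of the cusps. -/
def stdVertex : Colour → JLine
  | .A => toCurve ⊤ (.point rho)
  | .B => toCurve ⊤ (.point UpperHalfPlane.I)
  | .I => toCurve ⊤ (.cusp OnePoint.infty)

/-- The open hyperbolic segments joining `i` to `∞`, `ρ` to `∞` and `ρ` to `i`; each is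
indexed by the colour of the opposite vertex. -/
def stdArc : Colour → Set ℍ
  | .A => {z | z.re = 0 ∧ 1 < z.im}
  | .B => {z | z.re = -1 / 2 ∧ √3 / 2 < z.im}
  | .I => {z | ‖(z : ℂ)‖ = 1 ∧ -1 / 2 < z.re ∧ z.re < 0}

/-- The open edges of the standard triangulation of `ℙ¹`. These are the three open segments of
the real circle of the `j`-line, from `1` to `∞`, from `0` to `∞`, and from `0` to `1`. -/
def stdEdge (c : Colour) : Set JLine :=
  (fun z : ℍ => toCurve ⊤ (.point z)) '' stdArc c

/-- The two open triangles of the standard triangulation of `ℙ¹`: the images of the left and of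
the right half of the open standard fundamental domain of the modular group. -/
def stdTriangle : Bool → Set JLine
  | true => (fun z : ℍ => toCurve ⊤ (.point z)) '' {z | 1 < ‖(z : ℂ)‖ ∧ -1 / 2 < z.re ∧ z.re < 0}
  | false => (fun z : ℍ => toCurve ⊤ (.point z)) '' {z | 1 < ‖(z : ℂ)‖ ∧ 0 < z.re ∧ z.re < 1 / 2}

/-- The set of connected components of a subset `S` of a space. -/
def componentsOf {X : Type*} [TopologicalSpace X] (S : Set X) : Set (Set X) :=
  {C | ∃ x ∈ S, C = connectedComponentIn S x}

/-- A decomposition of a space into vertices with three colours, open edges and open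
two-dimensional cells. -/
structure ColouredDecomposition (X : Type*) where
  /-- The vertices of a given colour. -/
  vertices : Colour → Set X
  /-- The open edges. -/
  edges : Set (Set X)
  /-- The open triangles. -/
  triangles : Set (Set X)

/-- The `ABI`-triangulation of `M_Γ`: the preimage under `j_Γ` of the standard triangulation of
the sphere. Its vertices are the points over `A`, `B`, `I`, and its edges and triangles are the
connected components of the preimages of the open edges and open triangles of `ℙ¹`. -/
def abiTriangulation (Γ : Subgroup PSL(2, ℤ)) : ColouredDecomposition (ModularCurve Γ) where
  vertices c := jMap Γ ⁻¹' {stdVertex c}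
  edges := ⋃ c, componentsOf (jMap Γ ⁻¹' stdEdge c)
  triangles := ⋃ s, componentsOf (jMap Γ ⁻¹' stdTriangle s)

/-- The valence of a vertex: the number of edges having `x` as an end point. (The two ends of
an edge have different colours, so no edge has to be counted twice.) -/
def ColouredDecomposition.valence {X : Type*} [TopologicalSpace X]
    (τ : ColouredDecomposition X) (x : X) : ℕ∞ :=
  {e ∈ τ.edges | x ∈ closure e}.encard

/-- The vertices of colour `c` and valence `n` (for instance the `B₂`-vertices). -/
def ColouredDecomposition.verticesOfType {X : Type*} [TopologicalSpace X]
    (τ : ColouredDecomposition X) (c : Colour) (n : ℕ∞) : Set X :=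
  {x ∈ τ.vertices c | τ.valence x = n}

end JModular

end

noncomputable section

namespace JModular

open ModularGroup Monoid

/-! ### Splittings of central extensions -/

/-! Two facts carry the proof. First, `PSL(2, ℤ)` is the free product of the cyclic groups generated
by the classes of `S` and `rot`, of orders two and three (`freeProductHom_injective`,
`exists_monoidHom_PSL`). Second, every involution of `PSL(2, ℤ)` is conjugate to `S`
(`exists_conj_S_of_orderOf`).

If `Γ` has no involution, `S` acts without fixed points on the cosets `SL(2, ℤ) ⧸ Γ'`, so the two
cosets of each `S`-orbit can be given opposite signs. Correcting left multiplication by `S` with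
these signs gives a map of square one, and `-rot` has cube one. By the free product structure the
two maps define an action of `PSL(2, ℤ)` on the set `SL(2, ℤ)` that lifts left translation and
commutes with right translation by `Γ'` (`exists_lifted_action`). The orbit map of `1`, restricted
to `Γ`, is then a splitting; the structure of `Γ` itself never has to be determined.

Conversely, a splitting would lift an involution to a noncentral matrix of square one, and `SL(2,
ℤ)` has none. Splitting and triviality agree because the kernel is central.

For the triangulation, the vertices over `i` are the classes of the points `h • i`. Near `i` only
`±1` and `±S` identify points with points of the fundamental domain, so the edges at such a vertex
are the images under `h` and `h * S` of the two standard arcs ending at `i`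
(`edges_at_translate_I`). For either arc the two images coincide exactly when `h * S * h⁻¹` lies in
`Γ`, so valence two detects the conjugates of `S` in `Γ`. -/

/-- A central extension with a splitting is equivalent to the trivial extension. -/
theorem nonempty_equiv_trivialExtension {N E G : Type*} [Group N] [Group E] [Group G]
    (X : GroupExtension N E G) (hc : ∀ n e, X.inl n * e = e * X.inl n) (s : X.Splitting) :
    Nonempty (X.Equiv (trivialExtension N G)) := by
  let f : N × G →* E :=
    { toFun := fun p => X.inl p.1 * s p.2
      map_one' := by simp
      map_mul' := fun p q => by
        simp only [Prod.fst_mul, Prod.snd_mul, map_mul]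
        rw [mul_assoc, mul_assoc, ← mul_assoc (X.inl q.1), hc q.1 (s p.2), mul_assoc] }
  refine ⟨GroupExtension.Equiv.symm (GroupExtension.Equiv.ofMonoidHom f ?_ ?_)⟩
  · ext n
    change X.inl n * s 1 = X.inl n
    rw [map_one, mul_one]
  · ext p
    change X.rightHom (X.inl p.1 * s p.2) = p.2
    simp

/-- An extension equivalent to the trivial extension splits. -/
theorem nonempty_splitting_of_equiv {N E G : Type*} [Group N] [Group E] [Group G]
    (X : GroupExtension N E G) (e : X.Equiv (trivialExtension N G)) : Nonempty X.Splitting := by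
  refine ⟨⟨(e.symm.toMulEquiv : N × G →* E).comp (MonoidHom.inr N G), fun g => ?_⟩⟩
  exact e.symm.rightHom_map (1, g)

theorem signHom_neg_one : signHom (-1) = -1 := by
  ext i j; fin_cases i <;> fin_cases j <;> simp [coe_signHom]

theorem signHom_mul_comm (u : ℤˣ) (g : SL(2, ℤ)) : signHom u * g = g * signHom u := by
  rcases Int.units_eq_one_or u with rfl | rfl <;> simp [signHom_neg_one]

theorem mk_eq_one_iff (g : SL(2, ℤ)) : (g : PSL(2, ℤ)) = 1 ↔ g = 1 ∨ g = -1 := by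
  rw [QuotientGroup.eq_one_iff, mem_center_iff_signHom]
  constructor
  · rintro ⟨u, rfl⟩
    rcases Int.units_eq_one_or u with rfl | rfl <;> simp [signHom_neg_one]
  · rintro (rfl | rfl)
    exacts [⟨1, map_one _⟩, ⟨-1, signHom_neg_one⟩]

theorem mk_signHom_mul (u : ℤˣ) (g : SL(2, ℤ)) : ((signHom u * g : SL(2, ℤ)) : PSL(2, ℤ)) = g := by
  have h : ((signHom u : SL(2, ℤ)) : PSL(2, ℤ)) = 1 :=
    (QuotientGroup.eq_one_iff _).2 ((mem_center_iff_signHom _).2 ⟨u, rfl⟩)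
  rw [QuotientGroup.mk_mul, h, one_mul]

theorem mk_neg (g : SL(2, ℤ)) : ((-g : SL(2, ℤ)) : PSL(2, ℤ)) = g := by
  have := mk_signHom_mul (-1) g
  rwa [signHom_neg_one, neg_one_mul] at this

theorem S_mul_S : S * S = -1 := by decide

theorem mk_S_sq : (S : PSL(2, ℤ)) ^ 2 = 1 := by
  rw [pow_two, ← QuotientGroup.mk_mul, mk_eq_one_iff]
  exact Or.inr S_mul_S

theorem mk_S_ne_one : (S : PSL(2, ℤ)) ≠ 1 := by
  rw [Ne, mk_eq_one_iff]
  decide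

theorem orderOf_conj_S (x : SL(2, ℤ)) : orderOf ((x⁻¹ * S * x : SL(2, ℤ)) : PSL(2, ℤ)) = 2 := by
  apply orderOf_eq_prime
  · rw [← QuotientGroup.mk_pow, mk_eq_one_iff]
    right
    rw [pow_two, show x⁻¹ * S * x * (x⁻¹ * S * x) = x⁻¹ * (S * S) * x by group, S_mul_S]
    simp
  · intro h
    apply mk_S_ne_one
    rw [QuotientGroup.mk_mul, QuotientGroup.mk_mul, QuotientGroup.mk_inv] at h
    rw [mul_assoc, inv_mul_eq_one] at h
    exact (mul_eq_right.1 h.symm)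

/-! ### The modular group as a free product -/

/-- The homomorphism from the cyclic group of order `n` determined by an element whose `n`-th
power is trivial. -/
def cyclicHom {G : Type*} [Group G] (n : ℕ) (g : G) (hg : g ^ n = 1) :
    Multiplicative (ZMod n) →* G :=
  AddMonoidHom.toMultiplicativeLeft
    (ZMod.lift n ⟨zmultiplesHom (Additive G) (Additive.ofMul g), by
      simp [← ofMul_pow, hg]⟩)

theorem cyclicHom_natCast {G : Type*} [Group G] (n : ℕ) (g : G) (hg : g ^ n = 1) (k : ℕ) :
    cyclicHom n g hg (Multiplicative.ofAdd (k : ZMod n)) = g ^ k := by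
  have : ((k : ℤ) : ZMod n) = k := by simp
  rw [← this]
  simp only [cyclicHom, AddMonoidHom.toMultiplicativeLeft_apply_apply, toAdd_ofAdd]
  rw [ZMod.lift_coe]
  simp

/-- The order-six matrix `T S`, acting as `z ↦ 1 - 1 / z`. -/
def rot : SL(2, ℤ) := T * S

theorem rot_pow_three : rot ^ 3 = -1 := by decide

theorem mk_rot_pow_three : (rot : PSL(2, ℤ)) ^ 3 = 1 := by
  rw [← QuotientGroup.mk_pow, mk_eq_one_iff]
  exact Or.inr rot_pow_three

theorem closure_mk_S_rot : Subgroup.closure {(S : PSL(2, ℤ)), (rot : PSL(2, ℤ))} = ⊤ := by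
  have h := congrArg (Subgroup.map (QuotientGroup.mk' (Subgroup.center SL(2, ℤ))))
    SpecialLinearGroup.SL2Z_generators
  rw [MonoidHom.map_closure, ← MonoidHom.range_eq_map, QuotientGroup.range_mk',
    Set.image_pair] at h
  rw [eq_top_iff, ← h, Subgroup.closure_le]
  have hS : (S : PSL(2, ℤ)) ∈ Subgroup.closure {(S : PSL(2, ℤ)), (rot : PSL(2, ℤ))} :=
    Subgroup.subset_closure (by simp)
  rintro _ (rfl | rfl)
  · exact hS
  · have hR : (rot : PSL(2, ℤ)) ∈ Subgroup.closure {(S : PSL(2, ℤ)), (rot : PSL(2, ℤ))} :=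
      Subgroup.subset_closure (by simp)
    have : (QuotientGroup.mk' (Subgroup.center SL(2, ℤ))) T =
        (rot : PSL(2, ℤ)) * (S : PSL(2, ℤ))⁻¹ := by
      simp [rot]
    rw [this]
    exact mul_mem hR (inv_mem hS)

theorem re_S_smul (z : ℍ) : (S • z).re = -z.re / Complex.normSq z := by
  rw [UpperHalfPlane.modular_S_smul]
  change ((-(z : ℂ))⁻¹).re = _
  simp [Complex.inv_re, neg_div]

theorem re_rot_smul (z : ℍ) : (rot • z).re = 1 - z.re / Complex.normSq z := by
  rw [rot, mul_smul, re_T_smul, re_S_smul]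
  ring

theorem re_rot_sq_smul_pos {z : ℍ} (hz : z.re < 0) : 0 < ((rot ^ 2) • z).re := by
  -- Thus `rot ^ 2` acts as `z ↦ -1 / (z - 1)`, and `z - 1` has negative real part.
  have h : rot ^ 2 = S * T⁻¹ := by decide
  rw [h, mul_smul, re_S_smul, re_T_inv_smul]
  have := UpperHalfPlane.normSq_pos (T⁻¹ • z)
  apply div_pos _ this
  linarith

/-- The orders of the two cyclic factors of the modular group. -/
def factorOrder : Bool → ℕ
  | false => 2
  | true => 3

/-- The homomorphism from `ℤ₂ * ℤ₃` given by an involution and an element of order three. -/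
def freeProductHom {G : Type*} [Group G] (s u : G) (hs : s ^ 2 = 1) (hu : u ^ 3 = 1) (b : Bool) :
    Multiplicative (ZMod (factorOrder b)) →* G :=
  match b with
  | false => cyclicHom 2 s hs
  | true => cyclicHom 3 u hu

/-- Ping-pong on the half-planes `Re z < 0` and `0 < Re z`: `S` sends the right one into the left
one, while `rot` and `rot ^ 2` send the left one into the right one. With only two factors, the
ping-pong lemma needs one of them to have at least three elements. -/
theorem freeProductHom_injective : Function.Injective
    (CoprodI.lift (freeProductHom (S : PSL(2, ℤ)) (rot : PSL(2, ℤ)) mk_S_sq mk_rot_pow_three)) := by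
  let X : Bool → Set ExtHalfPlane
    | false => ExtHalfPlane.point '' {z | z.re < 0}
    | true => ExtHalfPlane.point '' {z | 0 < z.re}
  refine CoprodI.lift_injective_of_ping_pong _ (Or.inr ⟨true, ?_⟩) X ?_ ?_ ?_
  · change 3 ≤ Cardinal.mk (Multiplicative (ZMod 3))
    rw [Cardinal.mk_fintype]
    simp
  · rintro (_ | _)
    · exact ⟨_, ⟨⟨⟨-1, 1⟩, by simp⟩, show (-1 : ℝ) < 0 by norm_num, rfl⟩⟩
    · exact ⟨_, ⟨⟨⟨1, 1⟩, by simp⟩, show (0 : ℝ) < 1 by norm_num, rfl⟩⟩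
  · have hd : Disjoint (X false) (X true) := by
      rw [Set.disjoint_left]
      rintro _ ⟨z, hz, rfl⟩ ⟨w, hw, h⟩
      cases h
      exact lt_asymm (show z.re < 0 from hz) hw
    rintro (_ | _) (_ | _) h
    exacts [absurd rfl h, hd, hd.symm, absurd rfl h]
  · rintro (_ | _) (_ | _) h
    · exact absurd rfl h
    · intro g hg
      have hg' : freeProductHom (S : PSL(2, ℤ)) (rot : PSL(2, ℤ)) mk_S_sq mk_rot_pow_three false g =
          (S : PSL(2, ℤ)) := by
        have : ∀ g : Multiplicative (ZMod 2), g ≠ 1 → g = Multiplicative.ofAdd ((1 : ℕ) : ZMod 2) := by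
          decide
        rw [this g hg]
        exact (cyclicHom_natCast 2 _ mk_S_sq 1).trans (pow_one _)
      rw [hg']
      rintro _ ⟨_, ⟨z, hz, rfl⟩, rfl⟩
      refine ⟨S • z, ?_, rfl⟩
      change (S • z).re < 0
      rw [re_S_smul]
      exact div_neg_of_neg_of_pos (neg_neg_of_pos hz) z.normSq_pos
    · intro g hg
      have : ∀ g : Multiplicative (ZMod 3), g ≠ 1 → g = Multiplicative.ofAdd ((1 : ℕ) : ZMod 3) ∨
          g = Multiplicative.ofAdd ((2 : ℕ) : ZMod 3) := by
        decide
      rcases this g hg with hg | hg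
      · have hg' : freeProductHom (S : PSL(2, ℤ)) (rot : PSL(2, ℤ)) mk_S_sq mk_rot_pow_three true g =
            (rot : PSL(2, ℤ)) := by
          rw [hg]
          exact (cyclicHom_natCast 3 _ mk_rot_pow_three 1).trans (pow_one _)
        rw [hg']
        rintro _ ⟨_, ⟨z, hz, rfl⟩, rfl⟩
        refine ⟨rot • z, ?_, rfl⟩
        change 0 < (rot • z).re
        rw [re_rot_smul]
        have : z.re / Complex.normSq z < 0 := div_neg_of_neg_of_pos hz z.normSq_pos
        linarith
      · have hg' : freeProductHom (S : PSL(2, ℤ)) (rot : PSL(2, ℤ)) mk_S_sq mk_rot_pow_three true g =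
            ((rot ^ 2 : SL(2, ℤ)) : PSL(2, ℤ)) := by
          rw [hg]
          exact cyclicHom_natCast 3 _ mk_rot_pow_three 2
        rw [hg']
        rintro _ ⟨_, ⟨z, hz, rfl⟩, rfl⟩
        exact ⟨rot ^ 2 • z, re_rot_sq_smul_pos hz, rfl⟩
    · exact absurd rfl h

theorem freeProductHom_of_one {G : Type*} [Group G] (s u : G) (hs : s ^ 2 = 1) (hu : u ^ 3 = 1) :
    CoprodI.lift (freeProductHom s u hs hu) (CoprodI.of (i := false)
        (Multiplicative.ofAdd ((1 : ℕ) : ZMod 2))) = s ∧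
      CoprodI.lift (freeProductHom s u hs hu) (CoprodI.of (i := true)
        (Multiplicative.ofAdd ((1 : ℕ) : ZMod 3))) = u := by
  rw [CoprodI.lift_of, CoprodI.lift_of]
  exact ⟨(cyclicHom_natCast 2 s hs 1).trans (pow_one _),
    (cyclicHom_natCast 3 u hu 1).trans (pow_one _)⟩

theorem freeProductHom_surjective : Function.Surjective
    (CoprodI.lift (freeProductHom (S : PSL(2, ℤ)) (rot : PSL(2, ℤ)) mk_S_sq mk_rot_pow_three)) := by
  obtain ⟨hs, hu⟩ := freeProductHom_of_one (S : PSL(2, ℤ)) (rot : PSL(2, ℤ)) mk_S_sq mk_rot_pow_three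
  rw [← MonoidHom.range_eq_top, eq_top_iff, ← closure_mk_S_rot, Subgroup.closure_le]
  rintro _ (rfl | rfl)
  exacts [⟨_, hs⟩, ⟨_, hu⟩]

/-- `PSL(2, ℤ)` is the free product of cyclic groups of orders two and three. -/
theorem exists_monoidHom_PSL {G : Type*} [Group G] (s u : G) (hs : s ^ 2 = 1) (hu : u ^ 3 = 1) :
    ∃ φ : PSL(2, ℤ) →* G, φ S = s ∧ φ rot = u := by
  let e := MulEquiv.ofBijective _ ⟨freeProductHom_injective, freeProductHom_surjective⟩
  obtain ⟨h1, h2⟩ := freeProductHom_of_one (S : PSL(2, ℤ)) (rot : PSL(2, ℤ)) mk_S_sq mk_rot_pow_three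
  obtain ⟨h3, h4⟩ := freeProductHom_of_one s u hs hu
  refine ⟨(CoprodI.lift (freeProductHom s u hs hu)).comp (e.symm : _ →* _), ?_, ?_⟩
  · exact (congrArg (CoprodI.lift (freeProductHom s u hs hu)) (e.symm_apply_eq.2 h1.symm)).trans h3
  · exact (congrArg (CoprodI.lift (freeProductHom s u hs hu)) (e.symm_apply_eq.2 h2.symm)).trans h4

/-! ### Subgroups without elements of order two -/

theorem mem_preimage {Γ : Subgroup PSL(2, ℤ)} {g : SL(2, ℤ)} :
    g ∈ preimage Γ ↔ (g : PSL(2, ℤ)) ∈ Γ := Iff.rfl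

theorem neg_one_mem_preimage (Γ : Subgroup PSL(2, ℤ)) : -1 ∈ preimage Γ := by
  rw [mem_preimage, (mk_eq_one_iff (-1)).2 (Or.inr rfl)]
  exact Γ.one_mem

/-- If `Γ` has no element of order two, the sides of the `S`-edges of the coset graph can be
given opposite signs. -/
theorem exists_sign {Γ : Subgroup PSL(2, ℤ)} (h : ∀ g ∈ Γ, orderOf g ≠ 2) :
    ∃ f : SL(2, ℤ) → ℤˣ, (∀ x, ∀ γ ∈ preimage Γ, f (x * γ) = f x) ∧ ∀ x, f (S * x) = -f x := by
  classical
  let C := SL(2, ℤ) ⧸ preimage Γ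
  -- `S` is an involution on the cosets, without fixed points by hypothesis. Any linear order then
  -- separates the two members of each orbit, and the sign records which one is smaller.
  let _ : LinearOrder C := IsWellOrder.linearOrder WellOrderingRel
  have hne : ∀ x : SL(2, ℤ), ((x : SL(2, ℤ)) : C) ≠ (S * x : SL(2, ℤ)) := fun x hx => by
    rw [QuotientGroup.eq, ← mul_assoc, mem_preimage] at hx
    exact h _ hx (orderOf_conj_S x)
  have hSS : ∀ x : SL(2, ℤ), ((S * (S * x) : SL(2, ℤ)) : C) = (x : SL(2, ℤ)) := fun x => by
    rw [QuotientGroup.eq, ← mul_assoc, S_mul_S]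
    simpa using neg_one_mem_preimage Γ
  refine ⟨fun x => if (x : C) < (S * x : SL(2, ℤ)) then 1 else -1, fun x γ hγ => ?_, fun x => ?_⟩
  · have h1 : ∀ y : SL(2, ℤ), ((y * γ : SL(2, ℤ)) : C) = y := fun y => by
      rw [QuotientGroup.mk_mul_of_mem _ hγ]
    simp only [← mul_assoc, h1]
  · simp only [hSS]
    rcases lt_or_gt_of_ne (hne x) with h1 | h1
    · rw [if_neg h1.asymm, if_pos h1]
    · rw [if_pos h1, if_neg h1.asymm, neg_neg]

/-- If `Γ` has no element of order two, `PSL(2, ℤ)` acts on the set `SL(2, ℤ)`, compatibly with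
left translations of `PSL(2, ℤ)` and commuting with right translations by `Γ'`. -/
theorem exists_lifted_action {Γ : Subgroup PSL(2, ℤ)} (h : ∀ g ∈ Γ, orderOf g ≠ 2) :
    ∃ φ : PSL(2, ℤ) →* Equiv.Perm SL(2, ℤ), ∀ (g : PSL(2, ℤ)) (x : SL(2, ℤ)),
      ((φ g x : SL(2, ℤ)) : PSL(2, ℤ)) = g * x ∧ ∀ γ ∈ preimage Γ, φ g (x * γ) = φ g x * γ := by
  obtain ⟨f, hf, hfS⟩ := exists_sign h
  have hfneg : ∀ u x, f (signHom u * x) = f x := fun u x => by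
    rw [signHom_mul_comm]
    refine hf x _ ?_
    rw [mem_preimage, ← mul_one (signHom u), mk_signHom_mul]
    exact Γ.one_mem
  -- The two applications contribute the signs `f x` and `f (S * x) = -f x`, whose product `-1`
  -- cancels `S * S = -1`.
  have hS : Function.Involutive fun x : SL(2, ℤ) => signHom (f x) * (S * x) := fun x => by
    simp only
    rw [hfneg, hfS, ← mul_assoc S, ← signHom_mul_comm, mul_assoc, ← mul_assoc S, S_mul_S,
      ← mul_assoc, ← map_mul, neg_mul, Int.units_mul_self, signHom_neg_one]
    simp
  have hR : ∀ x : SL(2, ℤ), -(rot * -(rot * -(rot * x))) = x := fun x => by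
    have := rot_pow_three
    simp only [mul_neg, neg_neg, ← mul_assoc]
    rw [← pow_two, ← pow_succ, this]
    simp
  let u : Equiv.Perm SL(2, ℤ) :=
    { toFun := fun x => -(rot * x)
      invFun := fun x => -(rot * -(rot * x))
      left_inv := hR
      right_inv := hR }
  obtain ⟨φ, hφS, hφR⟩ := exists_monoidHom_PSL hS.toPerm u
    (Equiv.ext fun x => hS x) (Equiv.ext fun x => hR x)
  refine ⟨φ, fun g => ?_⟩
  have hg : g ∈ Subgroup.closure {(S : PSL(2, ℤ)), (rot : PSL(2, ℤ))} := by
    rw [closure_mk_S_rot]; trivial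
  induction hg using Subgroup.closure_induction with
  | mem g hg =>
    intro x
    rcases hg with rfl | rfl
    · rw [hφS]
      refine ⟨mk_signHom_mul _ _, fun γ hγ => ?_⟩
      change signHom (f (x * γ)) * (S * (x * γ)) = signHom (f x) * (S * x) * γ
      rw [hf x γ hγ, mul_assoc, mul_assoc]
    · rw [hφR]
      refine ⟨mk_neg _, fun γ hγ => ?_⟩
      change -(rot * (x * γ)) = -(rot * x) * γ
      rw [neg_mul, mul_assoc]
  | one => simp
  | mul g g' _ _ ih ih' =>
    intro x
    rw [map_mul, Equiv.Perm.mul_apply]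
    refine ⟨by rw [(ih _).1, (ih' _).1, mul_assoc], fun γ hγ => ?_⟩
    rw [Equiv.Perm.mul_apply, (ih' x).2 γ hγ, (ih _).2 γ hγ]
  | inv g _ ih =>
    intro x
    have hx : φ g (φ g⁻¹ x) = x := by
      rw [← Equiv.Perm.mul_apply, ← map_mul, mul_inv_cancel, map_one, Equiv.Perm.one_apply]
    refine ⟨?_, fun γ hγ => ?_⟩
    · rw [eq_inv_mul_iff_mul_eq, ← (ih _).1, hx]
    · apply (φ g).injective
      rw [(ih _).2 γ hγ, hx, ← Equiv.Perm.mul_apply, ← map_mul, mul_inv_cancel, map_one,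
        Equiv.Perm.one_apply]

/-- If `Γ` has no element of order two, then its central extension splits. -/
theorem nonempty_splitting {Γ : Subgroup PSL(2, ℤ)} (h : ∀ g ∈ Γ, orderOf g ≠ 2) :
    Nonempty (extension Γ).Splitting := by
  obtain ⟨φ, hφ⟩ := exists_lifted_action h
  have h1 : ∀ g : PSL(2, ℤ), ((φ g 1 : SL(2, ℤ)) : PSL(2, ℤ)) = g := fun g => by
    rw [(hφ g 1).1, QuotientGroup.mk_one, mul_one]
  have hmem : ∀ g : Γ, φ g 1 ∈ preimage Γ := fun g => by
    rw [mem_preimage, h1]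
    exact g.2
  refine ⟨⟨⟨⟨fun g => ⟨φ g 1, hmem g⟩, ?_⟩, fun g g' => ?_⟩, fun g => Subtype.ext (h1 g)⟩⟩
  · apply Subtype.ext
    simp
  · apply Subtype.ext
    change φ (g * g' : PSL(2, ℤ)) 1 = φ g 1 * φ g' 1
    -- Commutation with right translation by `φ g' 1` turns `φ g (φ g' 1)` into `φ g 1 * φ g' 1`.
    rw [map_mul, Equiv.Perm.mul_apply, ← (hφ g 1).2 _ (hmem g'), one_mul]

/-! ### Lifts of involutions, their fixed points and their conjugacy -/

theorem sq_apply (g : SL(2, ℤ)) :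
    (g ^ 2) 0 0 = g 0 0 ^ 2 + g 0 1 * g 1 0 ∧ (g ^ 2) 0 1 = g 0 1 * (g 0 0 + g 1 1) ∧
      (g ^ 2) 1 0 = g 1 0 * (g 0 0 + g 1 1) := by
  simp only [pow_two, Matrix.SpecialLinearGroup.coe_mul, Matrix.mul_apply, Fin.sum_univ_two]
  refine ⟨?_, ?_, ?_⟩ <;> first | trivial | ring

/-- A noncentral element of `SL(2, ℤ)` with central square has trace zero. -/
theorem trace_eq_zero_of_sq {g : SL(2, ℤ)} (h : g ^ 2 = 1 ∨ g ^ 2 = -1)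
    (h1 : ¬(g = 1 ∨ g = -1)) : g 1 1 = -g 0 0 := by
  have hd := g.det_coe
  rw [Matrix.det_fin_two] at hd
  obtain ⟨-, h01, h10⟩ := sq_apply g
  have hz : (g ^ 2) 0 1 = 0 ∧ (g ^ 2) 1 0 = 0 := by
    rcases h with h | h <;> rw [h] <;> simp
  rw [hz.1] at h01
  rw [hz.2] at h10
  -- The off-diagonal entries of `g ^ 2` are those of `g` times the trace, so a nonzero trace makes
  -- `g` diagonal of determinant one.
  by_contra ht
  have ht' : g 0 0 + g 1 1 ≠ 0 := fun h => ht (by linarith)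
  have e01 : g 0 1 = 0 := (mul_eq_zero.1 h01.symm).resolve_right ht'
  have e10 : g 1 0 = 0 := (mul_eq_zero.1 h10.symm).resolve_right ht'
  rw [e01, e10, zero_mul, sub_zero] at hd
  apply h1
  rcases Int.eq_one_or_neg_one_of_mul_eq_one' hd with ⟨e00, e11⟩ | ⟨e00, e11⟩
  · left
    ext i j; fin_cases i <;> fin_cases j <;> simp [e00, e01, e10, e11]
  · right
    ext i j; fin_cases i <;> fin_cases j <;> simp [e00, e01, e10, e11]

/-- Otherwise the trace vanishes, and then the upper left entry of `g ^ 2` is minus the determinant,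
that is `-1`. -/
theorem eq_one_or_neg_one_of_sq_eq_one {g : SL(2, ℤ)} (h : g ^ 2 = 1) : g = 1 ∨ g = -1 := by
  by_contra h1
  have ht := trace_eq_zero_of_sq (Or.inl h) h1
  have hd := g.det_coe
  rw [Matrix.det_fin_two, ht] at hd
  have h00 := (sq_apply g).1
  rw [h] at h00
  simp at h00
  linarith

/-- If the central extension of `Γ` splits, `Γ` has no element of order two. -/
theorem orderOf_ne_two_of_splitting {Γ : Subgroup PSL(2, ℤ)} (s : (extension Γ).Splitting) :
    ∀ g ∈ Γ, orderOf g ≠ 2 := by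
  intro g hg ho
  have hsq : (⟨g, hg⟩ : Γ) ^ 2 = 1 := Subtype.ext (by simpa [ho] using pow_orderOf_eq_one g)
  have h2 : ((s ⟨g, hg⟩ : preimage Γ) : SL(2, ℤ)) ^ 2 = 1 := by
    have := congrArg s hsq
    rw [map_pow, map_one] at this
    exact congrArg Subtype.val this
  have h3 : ((s ⟨g, hg⟩ : SL(2, ℤ)) : PSL(2, ℤ)) = g :=
    congrArg Subtype.val (s.rightInverse_rightHom ⟨g, hg⟩)
  rw [(mk_eq_one_iff _).2 (eq_one_or_neg_one_of_sq_eq_one h2)] at h3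
  rw [← h3, orderOf_one] at ho
  exact absurd ho (by norm_num)

/-- An element of `SL(2, ℤ)` of trace zero has a fixed point in the upper half-plane. -/
theorem exists_fixed_point {g : SL(2, ℤ)} (ht : g 1 1 = -g 0 0) : ∃ z : ℍ, g • z = z := by
  have hd := g.det_coe
  rw [Matrix.det_fin_two, ht] at hd
  have hc : g 1 0 ≠ 0 := fun h => by
    rw [h] at hd
    nlinarith [sq_nonneg (g 0 0)]
  have hc' : (g 1 0 : ℝ) ≠ 0 := by exact_mod_cast hc
  have hcC : (g 1 0 : ℂ) ≠ 0 := by exact_mod_cast hc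
  -- With trace zero, the fixed points are `(a ± i) / c` for `a = g 0 0`, `c = g 1 0`; the sign `e`
  -- selects the one in the upper half-plane.
  obtain ⟨e, he, hpos⟩ : ∃ e : ℝ, e ^ 2 = 1 ∧ 0 < e / g 1 0 := by
    rcases lt_or_gt_of_ne hc' with h | h
    · exact ⟨-1, by norm_num, div_pos_of_neg_of_neg (by norm_num) h⟩
    · exact ⟨1, by norm_num, by positivity⟩
  have heC : (e : ℂ) ^ 2 = 1 := by exact_mod_cast he
  have he0 : (e : ℂ) ≠ 0 := fun h => by rw [h] at heC; norm_num at heC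
  have hdC : (g 0 0 : ℂ) * -g 0 0 - g 0 1 * g 1 0 = 1 := by exact_mod_cast hd
  let z : ℍ := ⟨⟨g 0 0 / g 1 0, e / g 1 0⟩, hpos⟩
  have hz : (g 1 0 : ℂ) * z = g 0 0 + e * Complex.I := by
    apply Complex.ext
    · simp [z, mul_div_cancel₀ _ hc']
    · simp [z, mul_div_cancel₀ _ hc']
  refine ⟨z, UpperHalfPlane.ext ?_⟩
  rw [UpperHalfPlane.coe_specialLinearGroup_apply]
  simp only [algebraMap_int_eq, eq_intCast, Complex.ofReal_intCast, ht, Int.cast_neg]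
  push_cast
  rw [div_eq_iff (by rw [hz]; simpa using he0)]
  apply mul_left_cancel₀ hcC
  linear_combination (-hdC - (e : ℂ) ^ 2 * Complex.I_sq + heC -
    (g 1 0 * (z : ℂ) - g 0 0 + e * Complex.I) * hz)

/-- Every element of order two of `PSL(2, ℤ)` is conjugate to `S`. -/
theorem exists_conj_S_of_orderOf {g : PSL(2, ℤ)} (hg : orderOf g = 2) :
    ∃ h : SL(2, ℤ), ((h * S * h⁻¹ : SL(2, ℤ)) : PSL(2, ℤ)) = g := by
  obtain ⟨a, rfl⟩ := QuotientGroup.mk_surjective g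
  have h1 : ¬(a = 1 ∨ a = -1) := by
    rw [← mk_eq_one_iff]
    intro h
    rw [h, orderOf_one] at hg
    exact absurd hg (by norm_num)
  have h2 : a ^ 2 = 1 ∨ a ^ 2 = -1 := by
    rw [← mk_eq_one_iff, QuotientGroup.mk_pow]
    simpa [hg] using pow_orderOf_eq_one (a : PSL(2, ℤ))
  obtain ⟨z, hz⟩ := exists_fixed_point (trace_eq_zero_of_sq h2 h1)
  obtain ⟨k, hk⟩ := exists_smul_mem_fd z
  obtain ⟨b, hb⟩ : ∃ b, b = k * a * k⁻¹ := ⟨_, rfl⟩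
  have hab : a = k⁻¹ * b * k := by rw [hb]; group
  have hbz : b • k • z = k • z := by
    rw [hb, mul_smul, mul_smul, inv_smul_smul, hz]
  have hb1 : ¬(b = 1 ∨ b = -1) := by
    rintro (h | h) <;> rw [h] at hab <;> apply h1 <;> simp [hab]
  have hb2 : b ^ 2 = 1 ∨ b ^ 2 = -1 := by
    rw [hb, pow_two, show k * a * k⁻¹ * (k * a * k⁻¹) = k * a ^ 2 * k⁻¹ by rw [pow_two]; group]
    rcases h2 with h | h <;> simp [h]
  have hS : b = S ∨ b = -S := by
    -- Since `b` fixes a point of the fundamental domain, it belongs to a finite list of matrices;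
    -- among the noncentral ones, only `±S` have square `±1`.
    have := cases_of_mem_fd_smul_mem_fd hk (by rw [hbz]; exact hk)
    rcases this with h | ⟨h, -⟩ | ⟨h, -⟩ | ⟨h, -⟩ | ⟨h, -⟩ | ⟨h, -⟩ | ⟨h, -⟩ | ⟨h, -⟩ | ⟨h, -⟩ | ⟨h, -⟩
    · exact absurd h hb1
    · exfalso; rcases h with h | h <;> rw [h] at hb2 <;> revert hb2 <;> decide
    · exfalso; rcases h with h | h <;> rw [h] at hb2 <;> revert hb2 <;> decide
    · exact h
    all_goals exfalso; rcases h with h | h <;> rw [h] at hb2 <;> revert hb2 <;> decide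
  refine ⟨k⁻¹, ?_⟩
  rcases hS with h | h
  · rw [hab, h, inv_inv]
  · rw [hab, h, inv_inv, mul_neg, neg_mul, mk_neg]

open scoped Modular

/-! ### The orbit of a point near `i` -/

theorem normSq_eq (z : ℍ) : Complex.normSq z = z.re ^ 2 + z.im ^ 2 := by
  rw [Complex.normSq_apply, UpperHalfPlane.coe_re, UpperHalfPlane.coe_im]
  ring

theorem normSq_S_smul (z : ℍ) : Complex.normSq (S • z : ℍ) = (Complex.normSq z)⁻¹ := by
  rw [UpperHalfPlane.modular_S_smul]
  change Complex.normSq (-(z : ℂ))⁻¹ = _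
  rw [map_inv₀, Complex.normSq_neg]

theorem norm_eq_one_iff_normSq (z : ℍ) : ‖(z : ℂ)‖ = 1 ↔ Complex.normSq z = 1 := by
  rw [Complex.normSq_eq_norm_sq, pow_eq_one_iff_of_nonneg (norm_nonneg _) two_ne_zero]

theorem S_smul_I : S • UpperHalfPlane.I = UpperHalfPlane.I := by
  rw [stabilizer_I]
  simp

/-- The interior of the union of the fundamental domain and its image under `S`. -/
def nhdI : Set ℍ := {z | |z.re| < 1 / 2 ∧ 2 * |z.re| < Complex.normSq z}

theorem isOpen_nhdI : IsOpen nhdI := by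
  have h1 := UpperHalfPlane.continuous_re
  have h2 := Complex.continuous_normSq.comp UpperHalfPlane.continuous_coe
  exact (isOpen_lt h1.abs continuous_const).inter (isOpen_lt (continuous_const.mul h1.abs) h2)

theorem I_mem_nhdI : UpperHalfPlane.I ∈ nhdI := by
  simp [nhdI]

theorem abs_re_S_smul_lt {z : ℍ} (hz : z ∈ nhdI) : |(S • z).re| < 1 / 2 := by
  rw [re_S_smul, abs_div, abs_neg, abs_of_pos z.normSq_pos, div_lt_iff₀ z.normSq_pos]
  linarith [hz.2]

/-- A modular transformation moving a point of `nhdI` into the fundamental domain fixes `i`. -/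
theorem cases_of_mem_nhdI {z : ℍ} {g : SL(2, ℤ)} (hz : z ∈ nhdI) (hg : g • z ∈ 𝒟) :
    (g = 1 ∨ g = -1) ∨ (g = S ∨ g = -S) := by
  have key : ∀ (w : ℍ) (k : SL(2, ℤ)), 1 ≤ Complex.normSq w → |w.re| < 1 / 2 → k • w ∈ 𝒟 →
      (k = 1 ∨ k = -1) ∨ (k = S ∨ k = -S) := by
    intro w k h1 h2 hk
    -- The strict bound on the real part excludes the corners and the vertical sides of the
    -- fundamental domain, hence every case of the list except `±1` and `±S`.
    have hρ : w ≠ UpperHalfPlane.ρ := by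
      rintro rfl
      norm_num [UpperHalfPlane.ρ] at h2
    have hρ' : w ≠ (1 : ℝ) +ᵥ UpperHalfPlane.ρ := by
      rintro rfl
      norm_num [UpperHalfPlane.ρ, UpperHalfPlane.vadd_re] at h2
    have h3 : w.re ≠ -1 / 2 := fun h => by norm_num [h, abs_of_neg] at h2
    have h4 : w.re ≠ 1 / 2 := fun h => by norm_num [h, abs_of_pos] at h2
    have := cases_of_mem_fd_smul_mem_fd (z := w) ⟨h1, h2.le⟩ hk
    tauto
  rcases le_or_gt 1 (Complex.normSq z) with h | h
  · exact key z g h hz.1 hg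
  · have h1 : 1 ≤ Complex.normSq (S • z : ℍ) := by
      rw [normSq_S_smul]
      exact (one_le_inv₀ z.normSq_pos).2 h.le
    -- Inside the unit circle, `S • z` takes the place of `z`; this exchanges the alternatives `±1`
    -- and `±S` for `g`.
    have := key (S • z) (g * S⁻¹) h1 (abs_re_S_smul_lt hz) (by rwa [mul_smul, inv_smul_smul])
    simp only [mul_inv_eq_iff_eq_mul, one_mul, neg_mul, S_mul_S, neg_neg] at this
    tauto

theorem abs_re_smul_lt_of_mem_nhdI {z : ℍ} {g : SL(2, ℤ)} (hz : z ∈ nhdI) (hg : g • z ∈ 𝒟) :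
    |(g • z).re| < 1 / 2 := by
  rcases cases_of_mem_nhdI hz hg with (rfl | rfl) | (rfl | rfl)
  · simpa using hz.1
  · rw [ModularGroup.SL_neg_smul, one_smul]
    exact hz.1
  · exact abs_re_S_smul_lt hz
  · rw [ModularGroup.SL_neg_smul]
    exact abs_re_S_smul_lt hz

theorem stdArc_subset_fd (c : Colour) : stdArc c ⊆ 𝒟 := by
  intro z hz
  have h := normSq_eq z
  have him := z.im_pos
  cases c with
  | A =>
    obtain ⟨h1, h2⟩ := hz
    refine ⟨?_, by rw [h1]; norm_num⟩
    rw [h, h1]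
    nlinarith
  | B =>
    obtain ⟨h1, h2⟩ := hz
    refine ⟨?_, by rw [h1]; norm_num [abs_of_neg]⟩
    rw [h, h1]
    have := Real.sq_sqrt (show (0 : ℝ) ≤ 3 by norm_num)
    nlinarith [Real.sqrt_nonneg 3]
  | I =>
    obtain ⟨h1, h2, h3⟩ := hz
    exact ⟨((norm_eq_one_iff_normSq z).1 h1).ge, abs_le.2 ⟨by linarith, by linarith⟩⟩

/-- An open neighbourhood of an arc ending at `i` that meets no other translate of the arc. -/
def arcNhd : Colour → Set ℍ
  | .A => 𝒟ᵒ
  | _ => nhdI ∩ {z | z.re < 0}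

theorem isOpen_arcNhd (c : Colour) : IsOpen (arcNhd c) := by
  have h : IsOpen (nhdI ∩ {z | z.re < 0}) :=
    isOpen_nhdI.inter (isOpen_lt UpperHalfPlane.continuous_re continuous_const)
  cases c
  exacts [isOpen_fdo, h, h]

theorem stdArc_subset_arcNhd {c : Colour} (hc : c ≠ .B) : stdArc c ⊆ arcNhd c := by
  intro z hz
  cases c with
  | A =>
    refine ⟨?_, by rw [hz.1]; norm_num⟩
    rw [normSq_eq, hz.1]
    nlinarith [hz.2]
  | B => exact absurd rfl hc
  | I =>
    obtain ⟨h1, h2, h3⟩ := hz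
    refine ⟨⟨?_, ?_⟩, h3⟩
    · rw [abs_of_neg h3]
      linarith
    · rw [(norm_eq_one_iff_normSq z).1 h1, abs_of_neg h3]
      linarith

/-- On the imaginary axis this is the rigidity of the interior of the fundamental domain. On the
unit circle `±S` also has to be excluded: it moves `Re z < 0` to `0 < Re z`, away from the arc. -/
theorem mk_eq_one_of_mem_arcNhd {c : Colour} (hc : c ≠ .B) {z : ℍ} {g : SL(2, ℤ)}
    (hz : z ∈ arcNhd c) (hg : g • z ∈ stdArc c) : (g : PSL(2, ℤ)) = 1 := by
  rw [mk_eq_one_iff]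
  cases c with
  | A => exact eq_one_or_neg_one_of_mem_fdo_mem_fd hz (stdArc_subset_fd _ hg)
  | B => exact absurd rfl hc
  | I =>
    refine (cases_of_mem_nhdI hz.1 (stdArc_subset_fd _ hg)).resolve_right fun h => ?_
    have h1 : g • z = S • z := by
      rcases h with rfl | rfl
      exacts [rfl, ModularGroup.SL_neg_smul _ _]
    have h2 := hg.2.2
    rw [h1, re_S_smul] at h2
    exact h2.not_gt (div_pos (neg_pos.2 hz.2) z.normSq_pos)

theorem not_mem_stdArc_I_of_mem_stdArc_A {z : ℍ} (g : SL(2, ℤ)) (hz : z ∈ stdArc .A) :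
    g • z ∉ stdArc .I := by
  intro hg
  have h : g • z = z := by
    rcases eq_one_or_neg_one_of_mem_fdo_mem_fd (stdArc_subset_arcNhd (c := .A) (by simp) hz)
      (stdArc_subset_fd _ hg) with rfl | rfl
    · rw [one_smul]
    · rw [ModularGroup.SL_neg_smul, one_smul]
  rw [h] at hg
  exact hg.2.2.ne hz.1

theorem coe_image_stdArc_A :
    UpperHalfPlane.coe '' stdArc .A = (fun t : ℝ => (t : ℂ) * Complex.I) '' Set.Ioi 1 := by
  ext w
  constructor
  · rintro ⟨z, hz, rfl⟩
    refine ⟨z.im, hz.2, ?_⟩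
    apply Complex.ext
    · simpa using hz.1.symm
    · simp
  · rintro ⟨t, ht, rfl⟩
    have ht' : (0 : ℝ) < t := zero_lt_one.trans ht
    exact ⟨⟨(t : ℂ) * Complex.I, by simpa using ht'⟩,
      ⟨show ((t : ℂ) * Complex.I).re = 0 by simp,
        show 1 < ((t : ℂ) * Complex.I).im by simpa using ht⟩, rfl⟩

theorem coe_image_stdArc_I :
    UpperHalfPlane.coe '' stdArc .I =
      (fun t : ℝ => (t : ℂ) + (√(1 - t ^ 2) : ℝ) * Complex.I) '' Set.Ioo (-1 / 2) 0 := by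
  ext w
  constructor
  · rintro ⟨z, ⟨h1, h2⟩, rfl⟩
    refine ⟨z.re, h2, ?_⟩
    rw [norm_eq_one_iff_normSq, normSq_eq] at h1
    have : √(1 - z.re ^ 2) = z.im := by
      rw [← h1, add_sub_cancel_left, Real.sqrt_sq z.im_pos.le]
    simp only [this]
    apply Complex.ext <;> simp
  · rintro ⟨t, ht, rfl⟩
    have ht' : 0 < 1 - t ^ 2 := by nlinarith [ht.1, ht.2]
    refine ⟨⟨(t : ℂ) + (√(1 - t ^ 2) : ℝ) * Complex.I, by simpa using ht'⟩, ⟨?_, ?_⟩, rfl⟩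
    · rw [norm_eq_one_iff_normSq]
      change Complex.normSq ((t : ℂ) + (√(1 - t ^ 2) : ℝ) * Complex.I) = 1
      rw [Complex.normSq_add_mul_I, Real.sq_sqrt ht'.le]
      ring
    · change -1 / 2 < ((t : ℂ) + (√(1 - t ^ 2) : ℝ) * Complex.I).re ∧
        ((t : ℂ) + (√(1 - t ^ 2) : ℝ) * Complex.I).re < 0
      simpa using ht

theorem isPreconnected_stdArc {c : Colour} (hc : c ≠ .B) : IsPreconnected (stdArc c) := by
  rw [← UpperHalfPlane.isEmbedding_coe.isInducing.isPreconnected_image]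
  cases c with
  | A =>
    rw [coe_image_stdArc_A]
    exact isPreconnected_Ioi.image _ (by fun_prop)
  | B => exact absurd rfl hc
  | I =>
    rw [coe_image_stdArc_I]
    exact isPreconnected_Ioo.image _ (by fun_prop)

theorem I_mem_closure_stdArc {c : Colour} (hc : c ≠ .B) :
    UpperHalfPlane.I ∈ closure (stdArc c) := by
  rw [UpperHalfPlane.isEmbedding_coe.isInducing.closure_eq_preimage_closure_image]
  cases c with
  | A =>
    have h1 : (1 : ℝ) ∈ closure (Set.Ioi (1 : ℝ)) := by rw [closure_Ioi]; simp
    have hf : Continuous fun t : ℝ => (t : ℂ) * Complex.I := by fun_prop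
    rw [coe_image_stdArc_A]
    simpa using map_mem_closure hf h1 (Set.mapsTo_image _ _)
  | B => exact absurd rfl hc
  | I =>
    have h1 : (0 : ℝ) ∈ closure (Set.Ioo (-1 / 2 : ℝ) 0) := by
      rw [closure_Ioo (by norm_num)]
      norm_num
    have hf : Continuous fun t : ℝ => (t : ℂ) + (√(1 - t ^ 2) : ℝ) * Complex.I := by fun_prop
    rw [coe_image_stdArc_I]
    simpa using map_mem_closure hf h1 (Set.mapsTo_image _ _)

/-! ### The edges of the triangulation -/

variable {Γ : Subgroup PSL(2, ℤ)}

theorem toCurve_eq_iff {x y : ExtHalfPlane} :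
    toCurve Γ x = toCurve Γ y ↔ ∃ g : SL(2, ℤ), (g : PSL(2, ℤ)) ∈ Γ ∧ g • y = x := by
  refine Iff.trans Quotient.eq (Iff.trans MulAction.orbitRel_apply ?_)
  constructor
  · rintro ⟨⟨g, hg⟩, rfl⟩
    obtain ⟨a, rfl⟩ := QuotientGroup.mk_surjective g
    exact ⟨a, hg, rfl⟩
  · rintro ⟨a, ha, rfl⟩
    exact ⟨⟨a, ha⟩, rfl⟩

theorem toCurve_point_eq_iff {z w : ℍ} : toCurve Γ (.point z) = toCurve Γ (.point w) ↔
    ∃ g : SL(2, ℤ), (g : PSL(2, ℤ)) ∈ Γ ∧ g • w = z := by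
  rw [toCurve_eq_iff]
  simp only [smul_point, ExtHalfPlane.point.injEq]

theorem continuous_smul_upperHalfPlane (g : SL(2, ℤ)) : Continuous fun z : ℍ => g • z :=
  continuous_const_smul (g : GL (Fin 2) ℝ)

/-- The class in `M_Γ` of the translate of a point by `h`. -/
def translate (Γ : Subgroup PSL(2, ℤ)) (h : SL(2, ℤ)) (z : ℍ) : ModularCurve Γ :=
  toCurve Γ (.point (h • z))

theorem translate_eq_iff {h k : SL(2, ℤ)} {z w : ℍ} : translate Γ h z = translate Γ k w ↔
    ∃ g : SL(2, ℤ), (g : PSL(2, ℤ)) ∈ Γ ∧ w = (k⁻¹ * g⁻¹ * h) • z := by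
  rw [translate, translate, toCurve_point_eq_iff]
  refine exists_congr fun g => and_congr_right fun _ => ?_
  rw [mul_smul, mul_smul, eq_inv_smul_iff, eq_inv_smul_iff]

theorem continuous_translate (h : SL(2, ℤ)) : Continuous (translate Γ h) := by
  rw [continuous_def]
  intro U hU
  exact (show IsOpen {z : ℍ | toCurve Γ (.point z) ∈ U} from hU.1).preimage
    (continuous_smul_upperHalfPlane h)

theorem isOpenMap_translate (h : SL(2, ℤ)) : IsOpenMap (translate Γ h) := by
  intro V hV
  refine ⟨?_, fun γ hγ => ?_⟩
  · have : {z : ℍ | toCurve Γ (.point z) ∈ translate Γ h '' V} =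
        ⋃ g : {g : SL(2, ℤ) // (g : PSL(2, ℤ)) ∈ Γ}, {z | (h⁻¹ * (g : SL(2, ℤ))) • z ∈ V} := by
      ext z
      simp only [Set.mem_ofPred_eq, Set.mem_image, Set.mem_iUnion, Subtype.exists, translate,
        toCurve_point_eq_iff]
      constructor
      · rintro ⟨v, hv, g, hg, hgz⟩
        exact ⟨g, hg, by rwa [mul_smul, hgz, inv_smul_smul]⟩
      · rintro ⟨g, hg, hv⟩
        exact ⟨_, hv, g, hg, by rw [mul_smul, smul_inv_smul]⟩
    change IsOpen {z : ℍ | toCurve Γ (.point z) ∈ translate Γ h '' V}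
    rw [this]
    exact isOpen_iUnion fun g => hV.preimage (continuous_smul_upperHalfPlane _)
  -- The horoball condition is vacuous, since no cusp is equivalent to a point of the upper
  -- half-plane.
  · obtain ⟨v, -, hv⟩ := hγ
    obtain ⟨g, -, hg⟩ := toCurve_eq_iff.1 hv
    rw [smul_cusp, smul_cusp] at hg
    cases hg

theorem exists_translate_I_of_mem_vertices {x : ModularCurve Γ}
    (hx : x ∈ (abiTriangulation Γ).vertices .B) : ∃ h, x = translate Γ h UpperHalfPlane.I := by
  obtain ⟨y, rfl⟩ := Quotient.exists_rep x
  obtain ⟨g, -, hg⟩ := toCurve_eq_iff.1 (show toCurve ⊤ y = toCurve ⊤ (.point UpperHalfPlane.I) from hx)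
  exact ⟨g, by rw [← hg]; rfl⟩

theorem translate_I_mem_vertices (h : SL(2, ℤ)) :
    translate Γ h UpperHalfPlane.I ∈ (abiTriangulation Γ).vertices .B :=
  toCurve_eq_iff.2 ⟨h, trivial, rfl⟩

theorem mem_preimage_stdEdge_iff {c : Colour} {x : ModularCurve Γ} :
    x ∈ jMap Γ ⁻¹' stdEdge c ↔ ∃ h, ∃ a ∈ stdArc c, x = translate Γ h a := by
  constructor
  · obtain ⟨y, rfl⟩ := Quotient.exists_rep x
    rintro ⟨a, ha, hy⟩
    obtain ⟨g, -, hg⟩ := toCurve_eq_iff.1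
      (show toCurve ⊤ y = toCurve ⊤ (.point a) from hy.symm)
    exact ⟨g, a, ha, by rw [← hg]; rfl⟩
  · rintro ⟨h, a, ha, rfl⟩
    exact ⟨a, ha, (toCurve_eq_iff (Γ := ⊤)).2 ⟨h, trivial, rfl⟩ |>.symm⟩

/-- The open edge of `M_Γ` that is the image of a translate of a standard arc. -/
def edge (Γ : Subgroup PSL(2, ℤ)) (c : Colour) (h : SL(2, ℤ)) : Set (ModularCurve Γ) :=
  translate Γ h '' stdArc c

theorem edge_subset (c : Colour) (h : SL(2, ℤ)) : edge Γ c h ⊆ jMap Γ ⁻¹' stdEdge c := by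
  rintro _ ⟨a, ha, rfl⟩
  exact mem_preimage_stdEdge_iff.2 ⟨h, a, ha, rfl⟩

theorem edge_nonempty {c : Colour} (hc : c ≠ .B) (h : SL(2, ℤ)) : (edge Γ c h).Nonempty :=
  (closure_nonempty_iff.1 ⟨_, I_mem_closure_stdArc hc⟩).image _

theorem edge_congr (c : Colour) {h k : SL(2, ℤ)} (hk : ((h * k⁻¹ : SL(2, ℤ)) : PSL(2, ℤ)) ∈ Γ) :
    edge Γ c h = edge Γ c k := by
  refine Set.image_congr fun a _ => ?_
  rw [translate_eq_iff]
  exact ⟨h * k⁻¹, hk, by rw [show k⁻¹ * (h * k⁻¹)⁻¹ * h = 1 by group, one_smul]⟩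

/-- If a point of an edge lies in the neighbourhood of a second edge, the two edges coincide. -/
theorem mem_of_translate_mem_edge {c : Colour} (hc : c ≠ .B) {h k : SL(2, ℤ)} {z : ℍ}
    (hz : z ∈ arcNhd c) (hx : translate Γ h z ∈ edge Γ c k) :
    ((h * k⁻¹ : SL(2, ℤ)) : PSL(2, ℤ)) ∈ Γ := by
  obtain ⟨a, ha, hx⟩ := hx
  obtain ⟨g, hg, rfl⟩ := translate_eq_iff.1 hx.symm
  have := mk_eq_one_of_mem_arcNhd hc hz ha
  simp only [QuotientGroup.mk_mul, QuotientGroup.mk_inv] at this ⊢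
  have h1 : (h : PSL(2, ℤ)) = g * k := by
    rw [mul_assoc, inv_mul_eq_one, eq_inv_mul_iff_mul_eq] at this
    exact this.symm
  rw [h1, mul_inv_cancel_right]
  exact hg

theorem edge_eq_iff {c : Colour} (hc : c ≠ .B) {h k : SL(2, ℤ)} :
    edge Γ c h = edge Γ c k ↔ ((h * k⁻¹ : SL(2, ℤ)) : PSL(2, ℤ)) ∈ Γ := by
  refine ⟨fun he => ?_, edge_congr c⟩
  obtain ⟨_, a, ha, rfl⟩ := edge_nonempty (Γ := Γ) hc h
  exact mem_of_translate_mem_edge hc (stdArc_subset_arcNhd hc ha)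
    (he ▸ Set.mem_image_of_mem _ ha)

theorem edge_A_ne_edge_I (h k : SL(2, ℤ)) : edge Γ .A h ≠ edge Γ .I k := by
  intro he
  obtain ⟨_, a, ha, rfl⟩ := edge_nonempty (Γ := Γ) (c := .A) (by simp) h
  obtain ⟨b, hb, hx⟩ : translate Γ h a ∈ edge Γ .I k := he ▸ Set.mem_image_of_mem _ ha
  obtain ⟨g, -, rfl⟩ := translate_eq_iff.1 hx.symm
  exact not_mem_stdArc_I_of_mem_stdArc_A _ ha hb

/-- The connected components of the preimage of a standard edge ending at `i` are the images of
the translates of the standard arc. -/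
theorem connectedComponentIn_eq_edge {c : Colour} (hc : c ≠ .B) {h : SL(2, ℤ)}
    {x : ModularCurve Γ} (hx : x ∈ edge Γ c h) :
    connectedComponentIn (jMap Γ ⁻¹' stdEdge c) x = edge Γ c h := by
  have hxF := edge_subset c h hx
  have hxC := mem_connectedComponentIn hxF
  apply subset_antisymm
  · have hopen : ∀ k, IsOpen (translate Γ k '' arcNhd c) := fun k =>
      isOpenMap_translate k _ (isOpen_arcNhd c)
    have hsub : ∀ k, edge Γ c k ⊆ translate Γ k '' arcNhd c := fun k =>
      Set.image_mono (stdArc_subset_arcNhd hc)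
    have hCF := connectedComponentIn_subset (jMap Γ ⁻¹' stdEdge c) x
    have heq : ∀ k y, y ∈ connectedComponentIn (jMap Γ ⁻¹' stdEdge c) x →
        y ∈ translate Γ k '' arcNhd c → y ∈ edge Γ c k := by
      rintro k y hyC ⟨z, hz, rfl⟩
      obtain ⟨l, a, ha, hl⟩ := mem_preimage_stdEdge_iff.1 (hCF hyC)
      have hm : translate Γ k z ∈ edge Γ c l := ⟨a, ha, hl.symm⟩
      rwa [(edge_eq_iff hc).2 (mem_of_translate_mem_edge hc hz hm)]
    have heq' : ∀ k l y, y ∈ edge Γ c k → y ∈ edge Γ c l → edge Γ c k = edge Γ c l := by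
      rintro k l _ ⟨a, ha, rfl⟩ hl
      exact (edge_eq_iff hc).2 (mem_of_translate_mem_edge hc (stdArc_subset_arcNhd hc ha) hl)
    have hcover : connectedComponentIn (jMap Γ ⁻¹' stdEdge c) x ⊆ translate Γ h '' arcNhd c ∪
        ⋃ k : {k // edge Γ c k ≠ edge Γ c h}, translate Γ k '' arcNhd c := by
      intro y hy
      obtain ⟨l, a, ha, rfl⟩ := mem_preimage_stdEdge_iff.1 (hCF hy)
      have hl : translate Γ l a ∈ edge Γ c l := ⟨a, ha, rfl⟩
      by_cases he : edge Γ c l = edge Γ c h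
      · exact Or.inl (hsub h (he ▸ hl))
      · exact Or.inr (Set.mem_iUnion.2 ⟨⟨l, he⟩, hsub l hl⟩)
    have hdisj : connectedComponentIn (jMap Γ ⁻¹' stdEdge c) x ∩ (translate Γ h '' arcNhd c ∩
        ⋃ k : {k // edge Γ c k ≠ edge Γ c h}, translate Γ k '' arcNhd c) = ∅ := by
      rw [Set.eq_empty_iff_forall_notMem]
      rintro y ⟨hy, h1, h2⟩
      obtain ⟨k, hk⟩ := Set.mem_iUnion.1 h2
      exact k.2 (heq' _ _ y (heq k y hy hk) (heq h y hy h1))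
    rcases isPreconnected_iff_subset_of_disjoint.1 isPreconnected_connectedComponentIn _ _
      (hopen h) (isOpen_iUnion fun k : {k // edge Γ c k ≠ edge Γ c h} => hopen k) hcover hdisj with h1 | h1
    · exact fun y hy => heq h y hy (h1 hy)
    · obtain ⟨k, hk⟩ := Set.mem_iUnion.1 (h1 hxC)
      exact absurd (heq' _ _ x (heq k x hxC hk) hx) k.2
  · exact ((isPreconnected_stdArc hc).image _ (continuous_translate h).continuousOn)
      |>.subset_connectedComponentIn hx (edge_subset c h)

theorem edge_mem_edges {c : Colour} (hc : c ≠ .B) (h : SL(2, ℤ)) :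
    edge Γ c h ∈ (abiTriangulation Γ).edges := by
  obtain ⟨x, hx⟩ := edge_nonempty (Γ := Γ) hc h
  exact Set.mem_iUnion.2 ⟨c, x, edge_subset c h hx, (connectedComponentIn_eq_edge hc hx).symm⟩

/-! ### The valence of the vertices over `i` -/

theorem translate_mul_S_I (h : SL(2, ℤ)) :
    translate Γ (h * S) UpperHalfPlane.I = translate Γ h UpperHalfPlane.I := by
  rw [translate, translate, mul_smul, S_smul_I]

theorem translate_I_mem_closure_edge {c : Colour} (hc : c ≠ .B) (h : SL(2, ℤ)) :
    translate Γ h UpperHalfPlane.I ∈ closure (edge Γ c h) :=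
  map_mem_closure (continuous_translate h) (I_mem_closure_stdArc hc) (Set.mapsTo_image _ _)

/-- The image of `nhdI` is an open neighbourhood of the vertex, so it meets `e`. The matrix carrying
a point of `nhdI` to the standard arc is `±1` or `±S`, which gives the two alternatives. An arc of
colour `B` is impossible because it lies on `Re z = -1 / 2`. -/
theorem exists_of_mem_closure {c : Colour} {h : SL(2, ℤ)} {e : Set (ModularCurve Γ)}
    (he : e ⊆ jMap Γ ⁻¹' stdEdge c) (hx : translate Γ h UpperHalfPlane.I ∈ closure e) :
    c ≠ .B ∧ ∃ y ∈ e, y ∈ edge Γ c h ∨ y ∈ edge Γ c (h * S) := by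
  obtain ⟨_, ⟨w, hw, rfl⟩, hye⟩ := mem_closure_iff.1 hx _
    (isOpenMap_translate h _ isOpen_nhdI) (Set.mem_image_of_mem _ I_mem_nhdI)
  obtain ⟨k, a, ha, hka⟩ := mem_preimage_stdEdge_iff.1 (he hye)
  obtain ⟨g, hg, rfl⟩ := translate_eq_iff.1 hka
  have hfd := stdArc_subset_fd c ha
  refine ⟨?_, translate Γ h w, hye, ?_⟩
  · rintro rfl
    have := abs_re_smul_lt_of_mem_nhdI hw hfd
    rw [ha.1] at this
    norm_num [abs_of_neg] at this
  · have hmem : translate Γ h w ∈ edge Γ c k := ⟨_, ha, hka.symm⟩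
    have hcases := cases_of_mem_nhdI hw hfd
    have hS : ∀ b : SL(2, ℤ), b = S ∨ b = -S → (b : PSL(2, ℤ)) = S := by
      rintro b (rfl | rfl)
      exacts [rfl, mk_neg S]
    rcases hcases with h1 | h1
    · left
      rw [← mk_eq_one_iff] at h1
      simp only [QuotientGroup.mk_mul, QuotientGroup.mk_inv] at h1
      rwa [edge_congr c (k := k)]
      rw [mul_assoc, inv_mul_eq_one, eq_inv_mul_iff_mul_eq] at h1
      rw [QuotientGroup.mk_mul, QuotientGroup.mk_inv, ← h1, mul_inv_cancel_right]
      exact hg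
    · right
      replace h1 := hS _ h1
      simp only [QuotientGroup.mk_mul, QuotientGroup.mk_inv] at h1
      rwa [edge_congr c (k := k)]
      have h2 : (h : PSL(2, ℤ)) = g * k * S := by
        rw [← h1]; group
      have h3 := mk_S_sq
      rw [QuotientGroup.mk_mul, QuotientGroup.mk_mul, QuotientGroup.mk_inv, h2, mul_assoc _ _
        (S : PSL(2, ℤ)), ← pow_two, h3, mul_one, mul_inv_cancel_right]
      exact hg

/-- The edges ending at a vertex over `i`. -/
theorem edges_at_translate_I (h : SL(2, ℤ)) :
    {e ∈ (abiTriangulation Γ).edges | translate Γ h UpperHalfPlane.I ∈ closure e} =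
      {edge Γ .A h, edge Γ .A (h * S), edge Γ .I h, edge Γ .I (h * S)} := by
  ext e
  constructor
  · rintro ⟨he, hx⟩
    obtain ⟨c, y, hy, rfl⟩ := Set.mem_iUnion.1 he
    obtain ⟨hc, z, hz, hzE⟩ := exists_of_mem_closure (connectedComponentIn_subset _ _) hx
    rw [connectedComponentIn_eq hz]
    rcases hzE with hzE | hzE <;> rw [connectedComponentIn_eq_edge hc hzE] <;> cases c <;>
      simp_all
  · have key : ∀ c : Colour, c ≠ .B →
        edge Γ c h ∈ {e ∈ (abiTriangulation Γ).edges | translate Γ h UpperHalfPlane.I ∈ closure e} ∧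
        edge Γ c (h * S) ∈
          {e ∈ (abiTriangulation Γ).edges | translate Γ h UpperHalfPlane.I ∈ closure e} := by
      intro c hc
      refine ⟨⟨edge_mem_edges hc h, translate_I_mem_closure_edge hc h⟩, edge_mem_edges hc _, ?_⟩
      rw [← translate_mul_S_I]
      exact translate_I_mem_closure_edge hc _
    rintro (rfl | rfl | rfl | rfl)
    exacts [(key .A (by simp)).1, (key .A (by simp)).2, (key .I (by simp)).1, (key .I (by simp)).2]

theorem valence_translate_I_eq_two_iff (h : SL(2, ℤ)) :
    (abiTriangulation Γ).valence (translate Γ h UpperHalfPlane.I) = 2 ↔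
      ((h * S * h⁻¹ : SL(2, ℤ)) : PSL(2, ℤ)) ∈ Γ := by
  rw [ColouredDecomposition.valence, edges_at_translate_I]
  constructor
  · intro h2
    by_contra hn
    have hne : edge Γ .A (h * S) ≠ edge Γ .A h := fun he => hn ((edge_eq_iff (by simp)).1 he)
    -- Three distinct edges already contradict valence two, so the second edge of colour `I` is not
    -- needed.
    have h3 : ({edge Γ .A (h * S), edge Γ .A h, edge Γ .I h} : Set (Set (ModularCurve Γ))).encard
        = 3 := Set.encard_eq_three.2
      ⟨_, _, _, hne, edge_A_ne_edge_I _ _, edge_A_ne_edge_I _ _, rfl⟩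
    have hle := Set.encard_le_encard (show
      ({edge Γ .A (h * S), edge Γ .A h, edge Γ .I h} : Set (Set (ModularCurve Γ))) ⊆
        {edge Γ .A h, edge Γ .A (h * S), edge Γ .I h, edge Γ .I (h * S)} by
      rintro _ (rfl | rfl | rfl) <;> simp)
    rw [h2, h3] at hle
    exact absurd hle (by decide)
  · intro hm
    rw [edge_congr .A hm, edge_congr .I hm, Set.insert_idem, Set.pair_eq_singleton]
    exact Set.encard_pair (edge_A_ne_edge_I _ _)

/-- `M_Γ` has no `B₂`-vertices if and only if `Γ` has no element of order two. -/
theorem verticesOfType_B_two_eq_empty_iff :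
    (abiTriangulation Γ).verticesOfType .B 2 = ∅ ↔ ∀ g ∈ Γ, orderOf g ≠ 2 := by
  rw [Set.eq_empty_iff_forall_notMem]
  constructor
  · intro hB g hg ho
    obtain ⟨h, rfl⟩ := exists_conj_S_of_orderOf ho
    exact hB _ ⟨translate_I_mem_vertices h, (valence_translate_I_eq_two_iff h).2 hg⟩
  · rintro hB x ⟨hx, hv⟩
    obtain ⟨h, rfl⟩ := exists_translate_I_of_mem_vertices hx
    refine hB _ ((valence_translate_I_eq_two_iff h).1 hv) ?_
    simpa using orderOf_conj_S h⁻¹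

end JModular

end

theorem mainTheorem9 (Γ : Subgroup PSL(2, ℤ)) (hΓ : Γ.FiniteIndex) :
    [∀ g ∈ Γ, orderOf g ≠ 2,
      Nonempty (JModular.extension Γ).Splitting,
      Nonempty ((JModular.extension Γ).Equiv (JModular.trivialExtension ℤˣ Γ)),
      (JModular.abiTriangulation Γ).verticesOfType .B 2 = ∅].TFAE := by
  tfae_have 1 → 2 := JModular.nonempty_splitting
  tfae_have 2 → 1 := fun ⟨s⟩ => JModular.orderOf_ne_two_of_splitting s
  tfae_have 2 → 3 := fun ⟨s⟩ => JModular.nonempty_equiv_trivialExtension _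
    (fun u g => Subtype.ext (JModular.signHom_mul_comm u g)) s
  tfae_have 3 → 2 := fun ⟨e⟩ => JModular.nonempty_splitting_of_equiv _ e
  tfae_have 4 ↔ 1 := JModular.verticesOfType_B_two_eq_empty_iff
  tfae_finish
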